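/- Let $M\in\mathbb{N}$ and, for $j=1,\dots,M$, let $\mathcal{H}_j$ be a separable (real) Hilbert space with its Borel $\sigma$-algebra. Write $\mathcal{M}(X)$ for the set of Borel probability measures on $X$. For $\nu,\mu\in\mathcal{M}(X)$ let $D_{\mathrm{KL}}(\nu\|\mu)=\int_X \log\big(\frac{d\nu}{d\mu}\big)\frac{d\nu}{d\mu}\,d\mu\in[0,\infty]$ if $\nu\ll\mu$ (with $0\log 0=0$), and $D_{\mathrm{KL}}(\nu\|\mu)=+\infty$ otherwise. For $j=1,\dots,M$ let $\mathcal{A}_j\subset\mathcal{M}(\mathcal{H}_j)$ be closed with respect to weak convergence of probability measures, and let $\prod_{j=1}^M\mathcal{A}_j$ denote the set of product measures $\prod_{j=1}^M\nu^j$ with $\nu^j\in\mathcal{A}_j$ for all $j$. Let $\mu\in\mathcal{M}\big(\prod_{j=1}^M\mathcal{H}_j\big)$, and assume that there is $\nu\in\prod_{j=1}^M\mathcal{A}_j$ with $D_{\mathrm{KL}}(\nu\|\mu)<\infty$. Let $\nu_n=\prod_{j=1}^M\nu_n^j\in\prod_{j=1}^M\mathcal{A}_j$ be a sequence with $$D_{\mathrm{KL}}(\nu_n\|\mu)\longrightarrow\inf_{\nu\in\prod_{j=1}^M\mathcal{A}_j}D_{\mathrm{KL}}(\nu\|\mu)\qquad(n\to\infty).$$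 Then there are a subsequence $(\nu_{n_k})_k$ and a product measure $\nu_*=\prod_{j=1}^M\nu_*^j$ with $\nu_*^j\in\mathcal{A}_j$ for all $j$ such that (i) $\nu_*$ attains the above infimum and $\nu_{n_k}$ converges weakly to $\nu_*$; (ii) $\nu_{n_k}^j$ converges weakly to $\nu_*^j$ for each $j=1,\dots,M$. In addition, whenever a subsequence $(\nu_{n_k})_k$ converges weakly to a product probability measure $\nu_*=\prod_{j=1}^M\nu_*^j$ with $\nu_*^j\in\mathcal{M}(\mathcal{H}_j)$, then for each $j=1,\dots,M$ such that $\nu_{n_k}^j\ll\nu_*^j$ for all $k$, $\nu_{n_k}^j$ converges to $\nu_*^j$ in the total variation norm. -/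

import Mathlib

open MeasureTheory InformationTheory Filter Topology
open scoped ENNReal

noncomputable section

/-- The class of product measures `∏ j, ν j` whose factors satisfy `ν j ∈ A j`. -/
def productClass {M : ℕ} {H : Fin M → Type*} [∀ j, MeasurableSpace (H j)]
    (A : ∀ j, Set (ProbabilityMeasure (H j))) : Set (ProbabilityMeasure (∀ j, H j)) :=
  {ν | ∃ ν' : ∀ j, ProbabilityMeasure (H j), (∀ j, ν' j ∈ A j) ∧ ν = ProbabilityMeasure.pi ν'}

/-- The total variation norm of the signed measure `μ - ν`, that is `|μ - ν| (X)`. -/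
def tvNormSub {X : Type*} [MeasurableSpace X] (μ ν : ProbabilityMeasure X) : ℝ≥0∞ :=
  ((μ : Measure X).toSignedMeasure - (ν : Measure X).toSignedMeasure).totalVariation Set.univ

end

/-!
Everything rests on the variational formula
`klDiv ν μ = sup_f (∫ f dν - ∫ (e ^ f - 1) dμ)`, the supremum being over bounded functions.
The inequality `≥` is Young's inequality for `klFun` (`klDual_le_toReal_klDiv`); the other one follows
by truncating the log-likelihood ratio and Fatou's lemma (`exists_measurable_lt_klDual`), and the
competitor can be taken continuous (`exists_continuous_lt_klDual`). It has three consequences.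

* `klDiv_le_of_tendsto`: as a supremum of weakly continuous functionals, the divergence is weakly
  lower semicontinuous in its first argument.
* `isTightMeasureSet_klDiv_le`: testing with multiples of indicators, a bound on `klDiv ν μ` makes `ν`
  small where `μ` is very small, so sublevel sets inherit tightness from `μ`.
* `eventually_abs_measureReal_sub_le`: if `νₙ → ν` weakly and `klDiv νₙ μ → klDiv ν μ < ∞`, then a
  near-optimal bounded continuous `f` for `ν` is near-optimal for `νₙ` too. Perturbing `f` by small
  multiples of an indicator of `s` shows that `ν s` and `νₙ s` are both close to `∫ x in s, e ^ f dμ`,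
  uniformly in `s`.

A minimizing sequence has eventually bounded divergence, so by Prokhorov's theorem a subsequence
converges weakly. Its marginals converge to the marginals of the limit; since products depend
continuously on their factors, the limit is the product of its marginals, which lie in the closed sets
`A j`. By lower semicontinuity the limit is a minimizer. The same argument shows that any weak product
limit along a subsequence is a minimizer, so the divergences converge to that of the limit, and the
third consequence gives convergence in total variation of the products and hence of their marginals.
-/

/-! ### The variational formula for bounded measurable functions -/

/-- The functional `f ↦ ∫ f dν - ∫ (e ^ f - 1) dμ`, whose supremum over bounded `f` is
`klDiv ν μ`. It is the Legendre dual of the integral functional with integrand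
`klFun x = x log x + 1 - x`, so no logarithm of an integral occurs, unlike in the
Donsker-Varadhan formula. -/
noncomputable def klDual {X : Type*} [MeasurableSpace X] (ν μ : Measure X) (f : X → ℝ) : ℝ :=
  ∫ x, f x ∂ν - ∫ x, (Real.exp (f x) - 1) ∂μ

section Duality

variable {X : Type*} [MeasurableSpace X]

/-- Young's inequality for `klFun` and its convex conjugate `y ↦ e ^ y - 1`. -/
lemma mul_le_klFun_add_exp_sub_one {x : ℝ} (hx : 0 ≤ x) (y : ℝ) :
    x * y ≤ klFun x + (Real.exp y - 1) := by
  rcases hx.eq_or_lt with rfl | hx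
  · simp [klFun_zero, Real.exp_nonneg]
  · have h := mul_le_mul_of_nonneg_left (Real.add_one_le_exp (y - Real.log x)) hx.le
    rw [Real.exp_sub, Real.exp_log hx, mul_div_cancel₀ _ hx.ne'] at h
    rw [klFun_apply]
    linarith

lemma integrable_of_forall_abs_le {μ : Measure X} [IsFiniteMeasure μ] {f : X → ℝ} {K : ℝ}
    (hf : Measurable f) (hK : ∀ x, |f x| ≤ K) : Integrable f μ :=
  Integrable.of_bound hf.aestronglyMeasurable K (ae_of_all _ hK)

lemma integrable_exp_of_forall_abs_le {μ : Measure X} [IsFiniteMeasure μ] {f : X → ℝ} {K : ℝ}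
    (hf : Measurable f) (hK : ∀ x, |f x| ≤ K) : Integrable (fun x => Real.exp (f x)) μ := by
  refine integrable_of_forall_abs_le (K := Real.exp K) hf.exp fun x => ?_
  rw [abs_of_pos (Real.exp_pos _)]
  exact Real.exp_le_exp.2 ((le_abs_self _).trans (hK x))

lemma klDual_eq_sub_add {ν μ : Measure X} [IsFiniteMeasure μ] {f : X → ℝ} {K : ℝ}
    (hf : Measurable f) (hK : ∀ x, |f x| ≤ K) :
    klDual ν μ f = ∫ x, f x ∂ν - ∫ x, Real.exp (f x) ∂μ + μ.real Set.univ := by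
  rw [klDual, integral_sub (integrable_exp_of_forall_abs_le hf hK) (integrable_const _)]
  simp
  ring

lemma klDual_eq_integral_rnDeriv {ν μ : Measure X} [IsFiniteMeasure ν] [IsFiniteMeasure μ]
    (hac : ν ≪ μ) {f : X → ℝ} {K : ℝ} (hf : Measurable f) (hK : ∀ x, |f x| ≤ K) :
    Integrable (fun x => (ν.rnDeriv μ x).toReal * f x - (Real.exp (f x) - 1)) μ ∧
      klDual ν μ f = ∫ x, ((ν.rnDeriv μ x).toReal * f x - (Real.exp (f x) - 1)) ∂μ := by
  have h1 : Integrable (fun x => (ν.rnDeriv μ x).toReal * f x) μ :=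
    (integrable_toReal_rnDeriv_mul_iff hac).2 (integrable_of_forall_abs_le hf hK)
  have h2 : Integrable (fun x => Real.exp (f x) - 1) μ :=
    (integrable_exp_of_forall_abs_le hf hK).sub (integrable_const _)
  refine ⟨h1.sub h2, ?_⟩
  rw [integral_sub h1 h2, klDual, ← integral_rnDeriv_smul hac]
  rfl

theorem klDual_le_toReal_klDiv {ν μ : Measure X} [IsFiniteMeasure ν] [IsFiniteMeasure μ]
    (h : klDiv ν μ ≠ ∞) {f : X → ℝ} {K : ℝ} (hf : Measurable f) (hK : ∀ x, |f x| ≤ K) :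
    klDual ν μ f ≤ (klDiv ν μ).toReal := by
  obtain ⟨hac, hint⟩ := klDiv_ne_top_iff.1 h
  obtain ⟨h1, h2⟩ := klDual_eq_integral_rnDeriv hac hf hK
  rw [h2, toReal_klDiv_eq_integral_klFun hac]
  refine integral_mono h1 ((integrable_klFun_rnDeriv_iff hac).2 hint) fun x => ?_
  have := mul_le_klFun_add_exp_sub_one (x := (ν.rnDeriv μ x).toReal) ENNReal.toReal_nonneg (f x)
  simp only
  linarith

/-- The truncation of `p` to the interval `[e ^ (-n), e ^ n]`. -/
noncomputable def expClip (n : ℕ) (p : ℝ) : ℝ := max (Real.exp (-n)) (min p (Real.exp n))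

lemma expClip_pos (n : ℕ) (p : ℝ) : 0 < expClip n p :=
  (Real.exp_pos _).trans_le (le_max_left _ _)

lemma exp_neg_le_exp_natCast (n : ℕ) : Real.exp (-n) ≤ Real.exp n :=
  Real.exp_le_exp.2 (by have : (0 : ℝ) ≤ n := n.cast_nonneg; linarith)

lemma abs_log_expClip_le (n : ℕ) (p : ℝ) : |Real.log (expClip n p)| ≤ n := by
  rw [abs_le]
  refine ⟨(Real.le_log_iff_exp_le (expClip_pos n p)).2 (le_max_left _ _),
    (Real.log_le_iff_le_exp (expClip_pos n p)).2 ?_⟩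
  exact max_le (exp_neg_le_exp_natCast n) (min_le_right _ _)

/-- At the truncated logarithm, the dual integrand is nonnegative, which is what Fatou's lemma
needs: it is at least `klFun` of the truncation. -/
lemma mul_log_expClip_sub_nonneg (n : ℕ) (p : ℝ) :
    0 ≤ p * Real.log (expClip n p) - (Real.exp (Real.log (expClip n p)) - 1) := by
  have hk : 0 ≤ klFun (expClip n p) := klFun_nonneg (expClip_pos n p).le
  rw [klFun_apply] at hk
  rw [Real.exp_log (expClip_pos n p)]
  suffices h : 0 ≤ (p - expClip n p) * Real.log (expClip n p) by linarith
  have hn : (0 : ℝ) ≤ n := n.cast_nonneg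
  rcases lt_or_ge p (Real.exp (-n)) with h1 | h1
  · have h : expClip n p = Real.exp (-n) := max_eq_left ((min_le_left _ _).trans h1.le)
    rw [h, Real.log_exp]
    exact mul_nonneg_of_nonpos_of_nonpos (by linarith) (by linarith)
  rcases le_or_gt p (Real.exp n) with h2 | h2
  · have h : expClip n p = p := by rw [expClip, min_eq_left h2, max_eq_right h1]
    simp [h]
  · have h : expClip n p = Real.exp n := by
      rw [expClip, min_eq_right h2.le, max_eq_right (exp_neg_le_exp_natCast n)]
    rw [h, Real.log_exp]
    exact mul_nonneg (by linarith) hn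

lemma tendsto_mul_log_expClip_sub {p : ℝ} (hp : 0 ≤ p) :
    Tendsto (fun n => p * Real.log (expClip n p) - (Real.exp (Real.log (expClip n p)) - 1))
      atTop (𝓝 (klFun p)) := by
  have h0 : Tendsto (fun n : ℕ => Real.exp (-n)) atTop (𝓝 0) :=
    Real.tendsto_exp_neg_atTop_nhds_zero.comp tendsto_natCast_atTop_atTop
  have h1 : Tendsto (fun n : ℕ => Real.exp n) atTop atTop :=
    Real.tendsto_exp_atTop.comp tendsto_natCast_atTop_atTop
  simp_rw [Real.exp_log (expClip_pos _ _)]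
  rcases hp.eq_or_lt with rfl | hp
  · have h (n : ℕ) : expClip n 0 = Real.exp (-n) := by
      rw [expClip, min_eq_left (Real.exp_pos _).le, max_eq_left (Real.exp_pos _).le]
    simp only [h, zero_mul, klFun_zero]
    simpa using (h0.sub_const 1).const_sub 0
  · refine tendsto_const_nhds.congr' ?_
    filter_upwards [h0.eventually_le_const hp, h1.eventually_ge_atTop p] with n hn1 hn2
    have h : expClip n p = p := by rw [expClip, min_eq_left hn2, max_eq_right hn1]
    rw [h, klFun_apply]
    ring

/-- The bounded competitors are the truncations of the log-likelihood ratio if `ν ≪ μ`, and large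
multiples of the indicator of a set violating `ν ≪ μ` otherwise. -/
theorem exists_measurable_lt_klDual {ν μ : Measure X} [IsFiniteMeasure ν] [IsFiniteMeasure μ]
    {c : ℝ} (hc : ENNReal.ofReal c < klDiv ν μ) :
    ∃ (f : X → ℝ) (K : ℝ), Measurable f ∧ (∀ x, |f x| ≤ K) ∧ c < klDual ν μ f := by
  by_cases hac : ν ≪ μ
  · set p : X → ℝ := fun x => (ν.rnDeriv μ x).toReal
    have hpm : Measurable p := by fun_prop
    have hfm (n : ℕ) : Measurable fun x => Real.log (expClip n (p x)) :=
      (measurable_const.max (hpm.min measurable_const)).log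
    have hle : klDiv ν μ ≤ liminf (fun n => ENNReal.ofReal
        (klDual ν μ fun x => Real.log (expClip n (p x)))) atTop := by
      calc klDiv ν μ = ∫⁻ x, liminf (fun n => ENNReal.ofReal (p x * Real.log (expClip n (p x))
            - (Real.exp (Real.log (expClip n (p x))) - 1))) atTop ∂μ := by
            rw [klDiv_eq_lintegral_klFun_of_ac hac]
            refine lintegral_congr fun x => ?_
            exact ((ENNReal.continuous_ofReal.tendsto _).comp
              (tendsto_mul_log_expClip_sub ENNReal.toReal_nonneg)).liminf_eq.symm
        _ ≤ _ := lintegral_liminf_le fun n =>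
            ((hpm.mul (hfm n)).sub ((hfm n).exp.sub_const 1)).ennreal_ofReal
        _ = _ := by
            congr 1
            ext n
            obtain ⟨h1, h2⟩ :=
              klDual_eq_integral_rnDeriv hac (hfm n) fun x => abs_log_expClip_le n (p x)
            rw [h2, ofReal_integral_eq_lintegral_ofReal h1
              (ae_of_all _ fun x => mul_log_expClip_sub_nonneg n (p x))]
    obtain ⟨n, hn⟩ := (eventually_lt_of_lt_liminf (hc.trans_le hle)).exists
    exact ⟨_, n, hfm n, fun x => abs_log_expClip_le n (p x),
      (ENNReal.ofReal_lt_ofReal_iff'.1 hn).1⟩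
  -- On a `μ`-null set `s` charged by `ν`, multiples of the indicator make the dual arbitrarily
  -- large.
  · obtain ⟨s, hs, hμs, hνs⟩ : ∃ s, MeasurableSet s ∧ μ s = 0 ∧ ν s ≠ 0 := by
      by_contra! h
      exact hac (Measure.AbsolutelyContinuous.mk fun s hs h0 => h s hs h0)
    have hpos : 0 < ν.real s := ENNReal.toReal_pos hνs (measure_ne_top _ _)
    set t := (|c| + 1) / ν.real s with ht
    have htpos : 0 < t := by positivity
    refine ⟨s.indicator fun _ => t, t, measurable_const.indicator hs, fun x => ?_, ?_⟩
    · by_cases hx : x ∈ s <;> simp [hx, abs_of_pos htpos, htpos.le]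
    · have h0 : ∫ x, (Real.exp (s.indicator (fun _ => t) x) - 1) ∂μ = 0 := by
        refine integral_eq_zero_of_ae ?_
        filter_upwards [measure_eq_zero_iff_ae_notMem.1 hμs] with x hx
        simp [hx]
      rw [klDual, h0, integral_indicator_const _ hs, smul_eq_mul, ht, mul_div_cancel₀ _ hpos.ne']
      linarith [le_abs_self c]

end Duality

/-! ### Weak convergence: lower semicontinuity and tightness -/

section WeakConvergence

variable {X : Type*} [TopologicalSpace X] [MeasurableSpace X] [BorelSpace X]

lemma abs_exp_sub_exp_le {a b K : ℝ} (ha : |a| ≤ K) (hb : |b| ≤ K) :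
    |Real.exp a - Real.exp b| ≤ Real.exp K * |a - b| := by
  wlog hab : b ≤ a generalizing a b
  · rw [abs_sub_comm, abs_sub_comm a]
    exact this hb ha (le_of_not_ge hab)
  rw [abs_of_nonneg (sub_nonneg.2 (Real.exp_le_exp.2 hab)), abs_of_nonneg (sub_nonneg.2 hab)]
  have h1 := mul_le_mul_of_nonneg_left (Real.add_one_le_exp (b - a)) (Real.exp_pos a).le
  rw [← Real.exp_add, add_sub_cancel] at h1
  have h2 := mul_le_mul_of_nonneg_right (Real.exp_le_exp.2 ((le_abs_self a).trans ha))
    (sub_nonneg.2 hab)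
  linarith

/-- Clipping at `± K` does not increase the distance to a value in `[-K, K]`. -/
lemma abs_sub_clip_le {a b K : ℝ} (ha : |a| ≤ K) : |a - max (-K) (min b K)| ≤ |a - b| := by
  obtain ⟨h1, h2⟩ := abs_le.1 ha
  rcases le_total b K with hb | hb
  · rw [min_eq_left hb]
    rcases le_total (-K) b with hb' | hb'
    · rw [max_eq_right hb']
    · rw [max_eq_left hb', abs_of_nonneg (by linarith), abs_of_nonneg (by linarith)]
      linarith
  · rw [min_eq_right hb, max_eq_right (by linarith), abs_of_nonpos (by linarith),
      abs_of_nonpos (by linarith)]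
    linarith

/-- A bounded measurable competitor in the dual problem can be replaced by a bounded continuous
one, by density of bounded continuous functions in `L¹(ν + μ)`. -/
theorem exists_continuous_lt_klDual [TopologicalSpace.PseudoMetrizableSpace X]
    {ν μ : Measure X} [IsFiniteMeasure ν] [IsFiniteMeasure μ] {c : ℝ}
    (hc : ENNReal.ofReal c < klDiv ν μ) :
    ∃ (f : X → ℝ) (K : ℝ), Continuous f ∧ (∀ x, |f x| ≤ K) ∧ c < klDual ν μ f := by
  obtain ⟨f, K, hfm, hfK, hf⟩ := exists_measurable_lt_klDual hc
  set δ := klDual ν μ f - c with hδ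
  have hδ0 : 0 < δ := sub_pos.2 hf
  set ε := δ / (2 * (1 + Real.exp K)) with hε
  have hε0 : 0 < ε := by positivity
  obtain ⟨g, hg, hgi⟩ :=
    (integrable_of_forall_abs_le (μ := ν + μ) hfm hfK).exists_boundedContinuous_integral_sub_le hε0
  have hfg := (integrable_of_forall_abs_le (μ := ν + μ) hfm hfK).sub hgi
  rw [integrable_add_measure] at hfg
  have hsum : ∫ x, |f x - g x| ∂ν + ∫ x, |f x - g x| ∂μ ≤ ε := by
    have := integral_add_measure hfg.1.norm hfg.2.norm
    simp only [Pi.sub_apply, Real.norm_eq_abs] at this hg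
    rwa [← this]
  set k : X → ℝ := fun x => max (-K) (min (g x) K)
  have hkc : Continuous k := by fun_prop
  have hkK (x : X) : |k x| ≤ K := by
    have hK : 0 ≤ K := (abs_nonneg _).trans (hfK x)
    exact abs_le.2 ⟨le_max_left _ _, max_le (by linarith) (min_le_right _ _)⟩
  have hfk (x : X) : |f x - k x| ≤ |f x - g x| := abs_sub_clip_le (hfK x)
  refine ⟨k, K, hkc, hkK, ?_⟩
  have h1 : ∫ x, f x ∂ν - ∫ x, k x ∂ν ≤ ∫ x, |f x - g x| ∂ν := by
    rw [← integral_sub (integrable_of_forall_abs_le hfm hfK)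
      (integrable_of_forall_abs_le hkc.measurable hkK)]
    exact integral_mono ((integrable_of_forall_abs_le hfm hfK).sub
      (integrable_of_forall_abs_le hkc.measurable hkK)) hfg.1.norm
      fun x => (le_abs_self _).trans (hfk x)
  have h2 : ∫ x, Real.exp (k x) ∂μ - ∫ x, Real.exp (f x) ∂μ
      ≤ Real.exp K * ∫ x, |f x - g x| ∂μ := by
    rw [← integral_sub (integrable_exp_of_forall_abs_le hkc.measurable hkK)
      (integrable_exp_of_forall_abs_le hfm hfK), ← integral_const_mul]
    refine integral_mono ((integrable_exp_of_forall_abs_le hkc.measurable hkK).sub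
      (integrable_exp_of_forall_abs_le hfm hfK)) (hfg.2.norm.const_mul _) fun x => ?_
    refine (le_abs_self _).trans ((abs_exp_sub_exp_le (hkK x) (hfK x)).trans ?_)
    rw [abs_sub_comm]
    exact mul_le_mul_of_nonneg_left (hfk x) (Real.exp_pos K).le
  have h3 : 0 ≤ ∫ x, |f x - g x| ∂ν := integral_nonneg fun x => abs_nonneg _
  have h4 : 0 ≤ ∫ x, |f x - g x| ∂μ := integral_nonneg fun x => abs_nonneg _
  have h5 : (1 + Real.exp K) * ε = δ / 2 := by
    rw [hε]
    field_simp
  have h6 := mul_le_mul_of_nonneg_left hsum (by positivity : 0 ≤ 1 + Real.exp K)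
  have h7 := mul_nonneg (Real.exp_pos K).le h3
  have h8 := klDual_eq_sub_add (ν := ν) (μ := μ) hfm hfK
  rw [klDual_eq_sub_add hkc.measurable hkK]
  nlinarith

lemma tendsto_klDual {ι : Type*} {F : Filter ι} {νs : ι → ProbabilityMeasure X}
    {ν : ProbabilityMeasure X} (μ : Measure X) (h : Tendsto νs F (𝓝 ν)) {f : X → ℝ} {K : ℝ}
    (hf : Continuous f) (hK : ∀ x, |f x| ≤ K) :
    Tendsto (fun i => klDual (νs i : Measure X) μ f) F (𝓝 (klDual (ν : Measure X) μ f)) :=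
  (ProbabilityMeasure.tendsto_iff_forall_integral_tendsto.1 h
    (BoundedContinuousFunction.ofNormedAddCommGroup f hf K hK)).sub_const _

/-- Lower semicontinuity of the divergence in its first argument under weak convergence: it is a
supremum of the weakly continuous functionals `ν ↦ klDual ν μ f`. -/
theorem klDiv_le_of_tendsto [TopologicalSpace.PseudoMetrizableSpace X] {ι : Type*}
    {F : Filter ι} [F.NeBot] {νs : ι → ProbabilityMeasure X} {ν μ : ProbabilityMeasure X} {L : ℝ≥0∞}
    (h : Tendsto νs F (𝓝 ν))
    (hL : Tendsto (fun i => klDiv (νs i : Measure X) μ) F (𝓝 L)) :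
    klDiv (ν : Measure X) μ ≤ L := by
  refine le_of_forall_lt_imp_le_of_dense fun c hc => ?_
  have hc_top : c ≠ ∞ := hc.ne_top
  obtain ⟨f, K, hf, hK, hlt⟩ := exists_continuous_lt_klDual (c := c.toReal)
    (by rwa [ENNReal.ofReal_toReal hc_top])
  refine ge_of_tendsto hL ?_
  filter_upwards [(tendsto_klDual μ h hf hK).eventually_const_lt hlt] with i hi
  by_cases hi_top : klDiv (νs i : Measure X) μ = ∞
  · simp [hi_top]
  · rw [← ENNReal.toReal_le_toReal hc_top hi_top]
    exact hi.le.trans (klDual_le_toReal_klDiv hi_top hf.measurable hK)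

/-- Sublevel sets of the divergence are tight: testing the dual bound with a large multiple of the
indicator of the complement of a compact set carrying most of `μ`. -/
theorem isTightMeasureSet_klDiv_le [TopologicalSpace.IsCompletelyPseudoMetrizableSpace X]
    [SecondCountableTopology X] [T2Space X] (μ : ProbabilityMeasure X) {C : ℝ≥0∞} (hC : C ≠ ∞) :
    IsTightMeasureSet {((ν : ProbabilityMeasure X) : Measure X) |
      ν ∈ {ν : ProbabilityMeasure X | klDiv (ν : Measure X) μ ≤ C}} := by
  rw [isTightMeasureSet_iff_exists_isCompact_measure_compl_le]
  intro ε hε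
  rcases eq_or_ne ε ∞ with rfl | hε_top
  · exact ⟨∅, isCompact_empty, fun _ _ => le_top⟩
  have hε0 : 0 < ε.toReal := ENNReal.toReal_pos hε.ne' hε_top
  set t := (C.toReal + 1) / ε.toReal with ht
  have ht0 : 0 < t := by positivity
  obtain ⟨K, hK, hμK⟩ := isTightMeasureSet_iff_exists_isCompact_measure_compl_le.1
    (isTightMeasureSet_singleton (μ := (μ : Measure X))) (ENNReal.ofReal (Real.exp (-t)))
    (ENNReal.ofReal_pos.2 (Real.exp_pos _))
  refine ⟨K, hK, ?_⟩
  rintro _ ⟨ν, hν, rfl⟩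
  have hKm : MeasurableSet Kᶜ := hK.isClosed.measurableSet.compl
  have hμ : (μ : Measure X).real Kᶜ ≤ Real.exp (-t) :=
    ENNReal.toReal_le_of_le_ofReal (Real.exp_pos _).le (hμK _ rfl)
  have hν_top : klDiv (ν : Measure X) μ ≠ ∞ := ne_top_of_le_ne_top hC hν
  have hexp : ∫ x, (Real.exp (Kᶜ.indicator (fun _ => t) x) - 1) ∂(μ : Measure X)
      = (μ : Measure X).real Kᶜ * (Real.exp t - 1) := by
    rw [← smul_eq_mul, ← integral_indicator_const _ hKm]
    refine integral_congr_ae (ae_of_all _ fun x => ?_)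
    by_cases hx : x ∈ Kᶜ <;> simp [hx]
  have h := klDual_le_toReal_klDiv (K := t) hν_top (f := Kᶜ.indicator fun _ => t)
    (measurable_const.indicator hKm) fun x => by
      by_cases hx : x ∈ Kᶜ <;> simp [hx, abs_of_pos ht0, ht0.le]
  rw [klDual, hexp, integral_indicator_const _ hKm, smul_eq_mul] at h
  have h1 : (μ : Measure X).real Kᶜ * (Real.exp t - 1) ≤ 1 := by
    have h2 := mul_le_mul_of_nonneg_right hμ (Real.exp_pos t).le
    rw [← Real.exp_add, neg_add_cancel, Real.exp_zero] at h2
    nlinarith [measureReal_nonneg (μ := (μ : Measure X)) (s := Kᶜ)]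
  have h3 : (klDiv (ν : Measure X) μ).toReal ≤ C.toReal := ENNReal.toReal_mono hC hν
  have h4 : (ν : Measure X).real Kᶜ ≤ ε.toReal := by
    refine le_of_mul_le_mul_right ?_ ht0
    rw [ht, mul_div_cancel₀ _ hε0.ne', ← ht]
    linarith
  rwa [← ENNReal.toReal_le_toReal (measure_ne_top _ _) hε_top]

end WeakConvergence

/-! ### Convergence in total variation -/

lemma exp_indicator_le {X : Type*} {s : Set X} {r : ℝ} (hr : |r| ≤ 1) (x : X) :
    Real.exp (s.indicator (fun _ => r) x) ≤ 1 + s.indicator (fun _ => r) x + r ^ 2 := by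
  by_cases hx : x ∈ s
  · have := (abs_le.1 (Real.abs_exp_sub_one_sub_id_le hr)).2
    simp only [hx, Set.indicator_of_mem]
    linarith
  · simp [hx, sq_nonneg]

section TotalVariation

variable {X : Type*} [MeasurableSpace X]

/-- Perturbing a competitor `f` by `r` times an indicator: if `f` is optimal up to `η`, then `ν` is
close to the measure `e ^ f μ` on every measurable set. This is the linearized form of the
Pinsker-type bound for the pair `ν`, `e ^ f μ`. -/
lemma mul_measureReal_sub_setIntegral_exp_le {ν μ : Measure X} [IsFiniteMeasure ν]
    [IsFiniteMeasure μ] (h : klDiv ν μ ≠ ∞) {f : X → ℝ} {K η : ℝ} (hf : Measurable f)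
    (hK : ∀ x, |f x| ≤ K) (hη : (klDiv ν μ).toReal ≤ klDual ν μ f + η) {s : Set X}
    (hs : MeasurableSet s) {r : ℝ} (hr : |r| ≤ 1) :
    r * (ν.real s - ∫ x in s, Real.exp (f x) ∂μ) ≤ η + r ^ 2 * ∫ x, Real.exp (f x) ∂μ := by
  set g : X → ℝ := s.indicator fun _ => r with hg
  have hgm : Measurable g := measurable_const.indicator hs
  have hg1 (x : X) : |g x| ≤ 1 := by
    by_cases hx : x ∈ s <;> simp [hg, hx, hr]
  have hfg (x : X) : |f x + g x| ≤ K + 1 := (abs_add_le _ _).trans (add_le_add (hK x) (hg1 x))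
  have hfe := integrable_exp_of_forall_abs_le (μ := μ) hf hK
  have hge : Integrable (s.indicator fun x => r * Real.exp (f x)) μ :=
    (hfe.const_mul r).indicator hs
  have h1 := klDual_le_toReal_klDiv h (f := fun x => f x + g x) (hf.add hgm) hfg
  rw [klDual_eq_sub_add (f := fun x => f x + g x) (hf.add hgm) hfg,
    integral_add (integrable_of_forall_abs_le hf hK) (integrable_of_forall_abs_le hgm hg1),
    hg, integral_indicator_const _ hs, smul_eq_mul] at h1
  rw [klDual_eq_sub_add hf hK] at hη
  have h2 : ∫ x, Real.exp (f x + g x) ∂μ ≤ (1 + r ^ 2) * ∫ x, Real.exp (f x) ∂μ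
      + r * ∫ x in s, Real.exp (f x) ∂μ := by
    rw [← integral_const_mul, ← integral_const_mul, ← integral_indicator hs,
      ← integral_add (hfe.const_mul _) hge]
    refine integral_mono (integrable_exp_of_forall_abs_le (hf.add hgm) hfg)
      ((hfe.const_mul _).add hge) fun x => ?_
    have h3 := mul_le_mul_of_nonneg_left (exp_indicator_le (s := s) hr x) (Real.exp_pos (f x)).le
    simp only [Real.exp_add]
    refine h3.trans_eq ?_
    by_cases hx : x ∈ s <;> simp [hx] <;> ring
  linarith

/-- With `η = t ^ 2` the perturbation `r = ± t` gives closeness of order `t`. -/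
lemma abs_measureReal_sub_setIntegral_exp_le {ν μ : Measure X} [IsProbabilityMeasure ν]
    [IsFiniteMeasure μ] (h : klDiv ν μ ≠ ∞) {f : X → ℝ} {K t : ℝ} (hf : Measurable f)
    (hK : ∀ x, |f x| ≤ K) (ht0 : 0 < t) (ht1 : t ≤ 1)
    (hη : (klDiv ν μ).toReal ≤ klDual ν μ f + t ^ 2) {s : Set X} (hs : MeasurableSet s) :
    |ν.real s - ∫ x in s, Real.exp (f x) ∂μ| ≤ 7 * t := by
  have key {s : Set X} (hs : MeasurableSet s) {r : ℝ} (hr : |r| ≤ 1) :=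
    mul_measureReal_sub_setIntegral_exp_le h hf hK hη hs hr
  -- Taking `s = univ` and `r = -1/2` bounds the total mass of `e ^ f μ`.
  have hmass : ∫ x, Real.exp (f x) ∂μ ≤ 6 := by
    have h1 := key MeasurableSet.univ (r := -1 / 2) (by norm_num [abs_le])
    rw [setIntegral_univ, probReal_univ] at h1
    nlinarith
  have hr : |t| ≤ 1 := by rwa [abs_of_pos ht0]
  have h1 := key hs hr
  have h2 := key hs (r := -t) (by rwa [abs_neg])
  have h3 := mul_le_mul_of_nonneg_left hmass (sq_nonneg t)
  rw [abs_le]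
  constructor <;> refine le_of_mul_le_mul_left ?_ ht0 <;> linarith

lemma tvNormSub_le {μ ν : ProbabilityMeasure X} {ε : ℝ}
    (h : ∀ s, MeasurableSet s → |(μ : Measure X).real s - (ν : Measure X).real s| ≤ ε) :
    tvNormSub μ ν ≤ ENNReal.ofReal (2 * ε) := by
  set σ := (μ : Measure X).toSignedMeasure - (ν : Measure X).toSignedMeasure with hσ
  have happ {s : Set X} (hs : MeasurableSet s) :
      σ s = (μ : Measure X).real s - (ν : Measure X).real s := by
    rw [hσ, sub_apply, Measure.toSignedMeasure_apply_measurable hs,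
      Measure.toSignedMeasure_apply_measurable hs]
  obtain ⟨s, hs, hpos, hneg, hposPart, hnegPart⟩ := σ.toJordanDecomposition_spec
  have h1 : σ.toJordanDecomposition.posPart Set.univ ≤ ENNReal.ofReal ε := by
    rw [hposPart, σ.toMeasureOfZeroLE_apply hpos hs MeasurableSet.univ,
      ← ENNReal.ofReal_eq_coe_nnreal]
    refine ENNReal.ofReal_le_ofReal ?_
    rw [Set.inter_univ, happ hs]
    exact (abs_le.1 (h s hs)).2
  have h2 : σ.toJordanDecomposition.negPart Set.univ ≤ ENNReal.ofReal ε := by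
    rw [hnegPart, σ.toMeasureOfLEZero_apply hneg hs.compl MeasurableSet.univ,
      ← ENNReal.ofReal_eq_coe_nnreal]
    refine ENNReal.ofReal_le_ofReal ?_
    rw [Set.inter_univ, happ hs.compl]
    linarith [(abs_le.1 (h _ hs.compl)).1]
  have hε : 0 ≤ ε := (abs_nonneg _).trans (h ∅ MeasurableSet.empty)
  rw [two_mul, ENNReal.ofReal_add hε hε]
  exact add_le_add h1 h2

end TotalVariation

/-- Weak convergence together with convergence of the divergences to the (finite) divergence of the
limit forces convergence in total variation. A near-optimal bounded continuous competitor `f` for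
`ν` is also near-optimal for the `νs i`, so all of them are close to the one measure `e ^ f μ`. -/
theorem eventually_abs_measureReal_sub_le {X : Type*} [TopologicalSpace X]
    [TopologicalSpace.PseudoMetrizableSpace X] [MeasurableSpace X] [BorelSpace X]
    {ι : Type*} {F : Filter ι} {νs : ι → ProbabilityMeasure X} {ν μ : ProbabilityMeasure X}
    (hfin : klDiv (ν : Measure X) μ ≠ ∞) (h : Tendsto νs F (𝓝 ν))
    (hD : Tendsto (fun i => klDiv (νs i : Measure X) μ) F (𝓝 (klDiv (ν : Measure X) μ)))
    {ε : ℝ} (hε : 0 < ε) :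
    ∀ᶠ i in F, ∀ s, MeasurableSet s →
      |(νs i : Measure X).real s - (ν : Measure X).real s| ≤ ε := by
  set t := min 1 (ε / 14) with ht
  have ht0 : 0 < t := by positivity
  have ht1 : t ≤ 1 := min_le_left _ _
  have htε : 14 * t ≤ ε := by linarith [min_le_right 1 (ε / 14)]
  have ht2 : 0 < t ^ 2 / 3 := by positivity
  set D := (klDiv (ν : Measure X) μ).toReal with hDdef
  obtain ⟨f, K, hf, hK, hlt⟩ : ∃ (f : X → ℝ) (K : ℝ), Continuous f ∧ (∀ x, |f x| ≤ K) ∧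
      D - t ^ 2 / 3 < klDual (ν : Measure X) μ f := by
    -- If `D = 0`, no `c` satisfies `ENNReal.ofReal c < D`; then `f = 0` is optimal.
    rcases (ENNReal.toReal_nonneg : 0 ≤ D).eq_or_lt with h0 | h0
    · refine ⟨fun _ => 0, 0, continuous_const, by simp, ?_⟩
      rw [hDdef, ← h0]
      simpa [klDual] using pow_pos ht0 2
    · refine exists_continuous_lt_klDual ?_
      rw [← ENNReal.ofReal_toReal hfin]
      exact (ENNReal.ofReal_lt_ofReal_iff h0).2 (sub_lt_self _ ht2)
  have hDr := (ENNReal.tendsto_toReal hfin).comp hD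
  filter_upwards [(tendsto_klDual μ h hf hK).eventually_const_lt
      (sub_lt_self (klDual (ν : Measure X) μ f) ht2),
    hDr.eventually_lt_const (lt_add_of_pos_right _ ht2),
    hD.eventually_lt_const (lt_top_iff_ne_top.2 hfin)] with i h1 h2 h3 s hs
  simp only [Function.comp_apply] at h2
  have h4 := abs_measureReal_sub_setIntegral_exp_le h3.ne hf.measurable hK ht0 ht1
    (by linarith) hs
  have h5 := abs_measureReal_sub_setIntegral_exp_le hfin hf.measurable hK ht0 ht1
    (by linarith) hs
  rw [abs_le] at h4 h5 ⊢
  constructor <;> linarith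

/-! ### Marginals of product measures -/

section Product

variable {κ : Type*} [Fintype κ] {H : κ → Type*} [∀ j, MeasurableSpace (H j)]

lemma map_apply_probabilityMeasure_pi (ν : ∀ j, ProbabilityMeasure (H j)) (j : κ) :
    (ProbabilityMeasure.pi ν).map (measurable_pi_apply j).aemeasurable = ν j :=
  Subtype.ext (measurePreserving_eval (fun i => (ν i : Measure (H i))) j).map_eq

lemma measureReal_pi_preimage_eval (ν : ∀ j, ProbabilityMeasure (H j)) (j : κ) {s : Set (H j)}
    (hs : MeasurableSet s) :
    (ProbabilityMeasure.pi ν : Measure (∀ j, H j)).real (Function.eval j ⁻¹' s)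
      = (ν j : Measure (H j)).real s :=
  (measurePreserving_eval (fun i => (ν i : Measure (H i))) j).measureReal_preimage
    hs.nullMeasurableSet

variable [∀ j, TopologicalSpace (H j)] [∀ j, SecondCountableTopology (H j)] [∀ j, BorelSpace (H j)]

lemma tendsto_map_eval {ι : Type*} {F : Filter ι} {π : ι → ProbabilityMeasure (∀ j, H j)}
    {π' : ProbabilityMeasure (∀ j, H j)} (h : Tendsto π F (𝓝 π')) (j : κ) :
    Tendsto (fun i => (π i).map (measurable_pi_apply j).aemeasurable) F
      (𝓝 (π'.map (measurable_pi_apply j).aemeasurable)) :=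
  ProbabilityMeasure.tendsto_map_of_tendsto_of_continuous _ _ h (continuous_apply j)

lemma tendsto_of_tendsto_pi {ι : Type*} {F : Filter ι} {ν : ι → ∀ j, ProbabilityMeasure (H j)}
    {νs : ∀ j, ProbabilityMeasure (H j)}
    (h : Tendsto (fun i => ProbabilityMeasure.pi (ν i)) F (𝓝 (ProbabilityMeasure.pi νs)))
    (j : κ) : Tendsto (fun i => ν i j) F (𝓝 (νs j)) := by
  have h' := tendsto_map_eval h j
  rw [map_apply_probabilityMeasure_pi] at h'
  exact h'.congr fun i => map_apply_probabilityMeasure_pi (ν i) j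

end Product

/-! ### Minimizing sequences of product measures -/

theorem corollary6 {M : ℕ} {H : Fin M → Type*}
    [∀ j, NormedAddCommGroup (H j)] [∀ j, InnerProductSpace ℝ (H j)]
    [∀ j, CompleteSpace (H j)] [∀ j, SecondCountableTopology (H j)]
    [∀ j, MeasurableSpace (H j)] [∀ j, BorelSpace (H j)]
    (A : ∀ j, Set (ProbabilityMeasure (H j))) (hA : ∀ j, IsClosed (A j))
    (μ : ProbabilityMeasure (∀ j, H j))
    (hfin : ∃ ν ∈ productClass A, klDiv (ν : Measure (∀ j, H j)) μ < ∞)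
    (ν : ℕ → ∀ j, ProbabilityMeasure (H j)) (hν : ∀ n j, ν n j ∈ A j)
    (hmin : Tendsto
      (fun n => klDiv (ProbabilityMeasure.pi (ν n) : Measure (∀ j, H j)) μ) atTop
      (𝓝 (⨅ ν' ∈ productClass A, klDiv (ν' : Measure (∀ j, H j)) μ))) :
    -- a subsequence converges weakly to a product minimizer, and so does each factor
    (∃ (φ : ℕ → ℕ) (νs : ∀ j, ProbabilityMeasure (H j)), StrictMono φ ∧
      (∀ j, νs j ∈ A j) ∧
      klDiv (ProbabilityMeasure.pi νs : Measure (∀ j, H j)) μ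
        = ⨅ ν' ∈ productClass A, klDiv (ν' : Measure (∀ j, H j)) μ ∧
      Tendsto (fun n => ProbabilityMeasure.pi (ν (φ n))) atTop
        (𝓝 (ProbabilityMeasure.pi νs)) ∧
      ∀ j, Tendsto (fun n => ν (φ n) j) atTop (𝓝 (νs j))) ∧
    -- along every subsequence with a weak product limit: convergence in total variation
    (∀ (φ : ℕ → ℕ) (νs : ∀ j, ProbabilityMeasure (H j)), StrictMono φ →
      Tendsto (fun n => ProbabilityMeasure.pi (ν (φ n))) atTop
        (𝓝 (ProbabilityMeasure.pi νs)) →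
      ∀ j, (∀ n, (ν (φ n) j : Measure (H j)) ≪ (νs j : Measure (H j))) →
        Tendsto (fun n => tvNormSub (ν (φ n) j) (νs j)) atTop (𝓝 0)) := by
  set I := ⨅ ν' ∈ productClass A, klDiv (ν' : Measure (∀ j, H j)) μ
  have hI_top : I < ∞ := by
    obtain ⟨ν', hν', h⟩ := hfin
    exact (iInf₂_le ν' hν').trans_lt h
  -- A product measure that is a weak limit along a subsequence lies in the class and attains `I`.
  have hlim {φ : ℕ → ℕ} {νs : ∀ j, ProbabilityMeasure (H j)} (hφ : StrictMono φ)
      (h : Tendsto (fun n => ProbabilityMeasure.pi (ν (φ n))) atTop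
        (𝓝 (ProbabilityMeasure.pi νs))) :
      (∀ j, νs j ∈ A j) ∧ klDiv (ProbabilityMeasure.pi νs : Measure (∀ j, H j)) μ = I := by
    have hmem (j : Fin M) : νs j ∈ A j :=
      (hA j).mem_of_tendsto (tendsto_of_tendsto_pi h j) (Eventually.of_forall fun n => hν _ j)
    exact ⟨hmem, le_antisymm (klDiv_le_of_tendsto h (hmin.comp hφ.tendsto_atTop))
      (iInf₂_le _ ⟨νs, hmem, rfl⟩)⟩
  refine ⟨?_, fun φ νs hφ h j _ => ?_⟩
  · have hC : I + 1 ≠ ∞ := ENNReal.add_ne_top.2 ⟨hI_top.ne, ENNReal.one_ne_top⟩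
    have hev : ∀ᶠ n in atTop, ProbabilityMeasure.pi (ν n) ∈
        closure {π : ProbabilityMeasure (∀ j, H j) | klDiv (π : Measure (∀ j, H j)) μ ≤ I + 1} := by
      filter_upwards [hmin.eventually_le_const
        (ENNReal.lt_add_right hI_top.ne one_ne_zero)] with n hn
      exact subset_closure hn
    obtain ⟨π, -, φ, hφ, hπ⟩ := (isCompact_closure_of_isTightMeasureSet
      (isTightMeasureSet_klDiv_le μ hC)).tendsto_subseq' hev.frequently
    -- The factors converge to the marginals of `π`, so by continuity of `pi` in the factors and
    -- uniqueness of weak limits, `π` is itself a product.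
    set νs : ∀ j, ProbabilityMeasure (H j) :=
      fun j => π.map (measurable_pi_apply j).aemeasurable
    have hj (j : Fin M) : Tendsto (fun n => ν (φ n) j) atTop (𝓝 (νs j)) :=
      (tendsto_map_eval hπ j).congr fun n => map_apply_probabilityMeasure_pi (ν (φ n)) j
    have hpi : Tendsto (fun n => ProbabilityMeasure.pi (ν (φ n))) atTop
        (𝓝 (ProbabilityMeasure.pi νs)) :=
      (ProbabilityMeasure.continuous_pi.tendsto νs).comp (tendsto_pi_nhds.2 hj)
    obtain ⟨hmem, hval⟩ := hlim hφ hpi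
    exact ⟨φ, νs, hφ, hmem, hval, hpi, hj⟩
  · obtain ⟨-, hval⟩ := hlim hφ h
    have hD := hmin.comp hφ.tendsto_atTop
    rw [← hval] at hD
    refine ENNReal.tendsto_nhds_zero.2 fun ε hε => ?_
    rcases eq_or_ne ε ∞ with rfl | hε_top
    · exact Eventually.of_forall fun _ => le_top
    have hε0 : 0 < ε.toReal := ENNReal.toReal_pos hε.ne' hε_top
    filter_upwards [eventually_abs_measureReal_sub_le (hval.trans_ne hI_top.ne) h hD
      (half_pos hε0)] with n hn
    refine (tvNormSub_le (ε := ε.toReal / 2) fun s hs => ?_).trans_eq ?_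
    · simpa only [measureReal_pi_preimage_eval _ j hs] using hn _ (measurable_pi_apply j hs)
    · rw [mul_div_cancel₀ _ two_ne_zero, ENNReal.ofReal_toReal hε_top]
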